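/- Let $\mathcal D=(V,E)$ be a finite directed acyclic graph with positive edge weights $c_{ki}$ for each edge $k\to i$. Let $(Z_i)_{i\in V}$ be independent, almost surely positive, atom-free random variables (not necessarily identically distributed), each with support $[0,\infty)$. Let $(\varepsilon_i)_{i\in V}$ be i.i.d. atom-free random variables with $\varepsilon_i\ge 1$ almost surely and unbounded above, independent of the vector $(Z_i)_{i\in V}$. Let $\mathbf U=(U_i)_{i\in V}$ be a recursive max-linear vector with propagating noise, that is, almost surely $$U_i=\Big(\bigvee_{k\in \mathrm{pa}(i)}c_{ki}U_k\vee Z_i\Big)\varepsilon_i,\qquad i\in V,$$ where $\mathrm{pa}(i)=\{k: (k\to i)\in E\}$ and an empty maximum is $0$. For a directed path $p=[j=k_0\to k_1\to\dots\to k_n=i]$ with $n\ge 1$ put $d_{ji}(p)=\prod_{l=0}^{n-1}c_{k_lk_{l+1}}$ and $S_p=\{k_1,\dots,k_n\}$, and let $b_{ji}$ be the maximum of $d_{ji}(q)$ over all directed paths $q$ from $j$ to $i$. The path $p$ is called generic if it is the only path $q$ from $j$ to $i$ with $d_{ji}(q)=b_{ji}$. An almost surely positive random variable $Y$ with distribution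 function $F$ is called regularly varying at zero with exponent $\alpha>0$, written $Y\in RV^0_\alpha$, if $\lim_{t\downarrow 0}F(tx)/F(t)=x^\alpha$ for every $x>0$. Let $p$ be a directed path from $j$ to $i$ with at least one edge, and assume that $p$ is generic. If $\ln(\varepsilon_k)\in RV^0_\alpha$ for every $k\in V$ (equivalently, since the $\varepsilon_k$ are identically distributed, for some $k\in V$), then $$\ln(U_i/U_j)-\ln(b_{ji})\in RV^0_{|S_p|\,\alpha}.$$ -/

import Mathlib

open MeasureTheory ProbabilityTheory Filter Topology

/-- A directed acyclic graph: a digraph without directed cycles (in particular without loops). -/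
structure DAG (V : Type*) extends Digraph V where
  acyclic : ∀ v, ¬ Relation.TransGen Adj v v

namespace DAG

variable {V : Type*}

/-- Directed paths `j = k₀ → k₁ → ⋯ → kₙ = i` with at least one edge (`n ≥ 1`). -/
inductive Path (D : DAG V) : V → V → Type _
  | edge {j i : V} (h : D.Adj j i) : Path D j i
  | cons {j k i : V} (h : D.Adj j k) (p : Path D k i) : Path D j i

namespace Path

variable {D : DAG V}

/-- The path weight `d_{ji}(p)`: the product of the weights of the edges of `p`. -/
def weight (C : V → V → ℝ) : {j i : V} → D.Path j i → ℝ
  | j, i, edge _ => C j i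
  | j, _, cons (k := k) _ p => C j k * p.weight C

/-- The node set `S_p = {k₁, …, kₙ}` of a path, excluding the initial node. -/
def nodeSet [DecidableEq V] : {j i : V} → D.Path j i → Finset V
  | _, i, edge _ => {i}
  | _, _, cons (k := k) _ p => insert k p.nodeSet

end Path

/-- `C` is an edge weight matrix on `D`: `c_{ji} > 0` for every edge `j → i`, all other entries
vanish. -/
def IsEdgeWeight (D : DAG V) (C : V → V → ℝ) : Prop :=
  (∀ j i, D.Adj j i → 0 < C j i) ∧ ∀ j i, ¬ D.Adj j i → C j i = 0

/-- The max-linear coefficient `b_{ji}`: the maximum of the path weights over all paths from `j` to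
`i` if `j` is an ancestor of `i`, `1` if `j = i`, and `0` otherwise (an empty supremum in `ℝ`
is `0`). -/
noncomputable def mlCoeff [DecidableEq V] (D : DAG V) (C : V → V → ℝ) (j i : V) : ℝ :=
  if j = i then 1 else ⨆ p : D.Path j i, p.weight C

/-- A path `p` from `j` to `i` is generic if it is the only path with `d_{ji}(p) = b_{ji}`. -/
def Path.IsGeneric [DecidableEq V] {D : DAG V} (C : V → V → ℝ) {j i : V} (p : D.Path j i) : Prop :=
  p.weight C = D.mlCoeff C j i ∧ ∀ q : D.Path j i, q.weight C = D.mlCoeff C j i → q = p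

/-- `U` is a recursive max-linear vector with propagating noise on the DAG `D` with edge weight
matrix `C`, innovations `Z` and noise variables `ε`:
`U i = ((⋁_{k ∈ pa(i)} c_{ki} U k) ∨ Z i) ε i`, an empty maximum being `0`. -/
structure IsRecursiveMLNoise {Ω : Type*} [MeasurableSpace Ω] (D : DAG V) (C : V → V → ℝ)
    (μ : Measure Ω) (Z ε U : V → Ω → ℝ) : Prop where
  edgeWeight : D.IsEdgeWeight C
  measurable_Z : ∀ i, Measurable (Z i)
  measurable_eps : ∀ i, Measurable (ε i)
  measurable_U : ∀ i, Measurable (U i)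
  Z_pos : ∀ i, ∀ᵐ ω ∂μ, 0 < Z i ω
  Z_support : ∀ i, (μ.map (Z i)).support = Set.Ici 0
  Z_atomFree : ∀ i x, μ {ω | Z i ω = x} = 0
  Z_indep : iIndepFun Z μ
  eps_one_le : ∀ i, ∀ᵐ ω ∂μ, 1 ≤ ε i ω
  eps_unbounded : ∀ i x, 0 < μ {ω | x < ε i ω}
  eps_atomFree : ∀ i x, μ {ω | ε i ω = x} = 0
  eps_indep : iIndepFun ε μ
  eps_identDistrib : ∀ i k, IdentDistrib (ε i) (ε k) μ μ
  eps_indep_Z : IndepFun (fun ω i => ε i ω) (fun ω i => Z i ω) μ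
  recursion : ∀ i, ∀ᵐ ω ∂μ,
    U i ω = ((⨆ k : {k : V // D.Adj k i}, C k i * U k ω) ⊔ Z i ω) * ε i ω

end DAG

/-- A (real) random variable `Y` is regularly varying at zero with exponent `α > 0`: it is almost
surely positive and its distribution function `F` satisfies `F (t x) / F t → x ^ α` as `t ↓ 0`, for
every `x > 0`. -/
def RegVaryingAtZero {Ω : Type*} [MeasurableSpace Ω] (μ : Measure Ω) (Y : Ω → ℝ) (α : ℝ) : Prop :=
  0 < α ∧ AEMeasurable Y μ ∧ (∀ᵐ ω ∂μ, 0 < Y ω) ∧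
    ∀ x : ℝ, 0 < x →
      Tendsto (fun t : ℝ => μ.real {ω | Y ω ≤ t * x} / μ.real {ω | Y ω ≤ t}) (𝓝[>] 0) (𝓝 (x ^ α))

/-! Put `W = ∑_{k ∈ S_p} ln ε_k` and `Y = ln(U_i/U_j) - ln b_{ji}`, and let `Y₀` be the analogue of
`Y` for the solution `U₀` of the recursion with the noise on `S_p` replaced by 1. Following `p`
gives `Y ≥ W`; monotonicity in the noise gives `Y ≥ Y₀`; switching off the noise on `S_p` lowers
`U_i` by at most the factor `exp W`, so `Y ≤ W + Y₀`. Both comparisons with `Y₀` use that `U_j` is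
unaffected, since all nodes of `S_p` are strict descendants of `j` (`ae_log_ratio_bounds`).

As `Y₀` depends only on `Z` and the noise off `S_p`, it is independent of `W`. Hence `P(W ≤ t) P(Y₀
≤ 0) ≤ P(Y ≤ t) ≤ P(W ≤ t) P(Y₀ ≤ t)`, and `P(Y ≤ t) / P(W ≤ t)` tends to `P(Y₀ ≤ 0)` as `t ↓ 0`. If
this limit is positive, `Y` inherits the exponent of `W` (`RegVaryingAtZero.of_squeeze`).

Positivity is where genericity enters: if `Z_j` is large, the other innovations are tiny and the
remaining noise is near 1, then no competing path beats `p` (`Path.IsGeneric.exists_le`), and this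
event has positive probability.

That `W` has exponent `|S_p| α` is a convolution statement: exponents add over independent summands
(`RegVaryingAtZero.add`). -/

/-! ### Limits of ratios. -/

/-- Regular variation at zero is inherited along asymptotic proportionality. -/
theorem tendsto_div_of_tendsto_ratio {f g : ℝ → ℝ} {c a x : ℝ} (hx : 0 < x) (hc : c ≠ 0)
    (hfg : Tendsto (fun t => f t / g t) (𝓝[>] 0) (𝓝 c))
    (hg : Tendsto (fun t => g (t * x) / g t) (𝓝[>] 0) (𝓝 a)) :
    Tendsto (fun t => f (t * x) / f t) (𝓝[>] 0) (𝓝 a) := by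
  have hs : Tendsto (fun t : ℝ => t * x) (𝓝[>] 0) (𝓝[>] 0) := by
    refine tendsto_nhdsWithin_iff.2 ⟨?_, ?_⟩
    · have : Tendsto (fun t : ℝ => t * x) (𝓝 0) (𝓝 (0 * x)) := tendsto_id.mul_const x
      rw [zero_mul] at this
      exact this.mono_left nhdsWithin_le_nhds
    · filter_upwards [self_mem_nhdsWithin] with t ht
      exact mul_pos ht hx
  -- Factor `f(tx)/f(t)` as `f(tx)/g(tx) · g(tx)/g(t) · (f(t)/g(t))⁻¹`; the outer limits `c` and
  -- `c⁻¹` cancel.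
  have h := ((hfg.comp hs).mul hg).mul (hfg.inv₀ hc)
  rw [mul_right_comm, mul_inv_cancel₀ hc, one_mul] at h
  refine h.congr' ?_
  filter_upwards [hfg.eventually_ne hc, hs.eventually (hfg.eventually_ne hc)] with t h1 h2
  obtain ⟨h1a, h1b⟩ := div_ne_zero_iff.1 h1
  obtain ⟨h2a, h2b⟩ := div_ne_zero_iff.1 h2
  simp only [Function.comp_apply]
  field_simp

/-- A real function that is eventually squeezed between constants arbitrarily close to each other
converges. -/
theorem exists_tendsto_of_forall_eventually_mem_Icc {ι : Type*} {l : Filter ι} [l.NeBot]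
    {f : ι → ℝ}
    (h : ∀ δ > 0, ∃ a b : ℝ, b - a < δ ∧ ∀ᶠ t in l, f t ∈ Set.Icc a b) :
    ∃ c, Tendsto f l (𝓝 c) := by
  have hC : Cauchy (map f l) := by
    rw [Metric.cauchy_iff]
    refine ⟨inferInstance, fun δ hδ => ?_⟩
    obtain ⟨a, b, hab, hev⟩ := h δ hδ
    refine ⟨Set.Icc a b, hev, fun x hx y hy => ?_⟩
    rw [Real.dist_eq, abs_lt]
    constructor <;> linarith [hx.1, hx.2, hy.1, hy.2]
  exact CompleteSpace.complete hC

/-! ### Sums of independent regularly varying variables. -/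

section Convolution

variable {Ω : Type*} [MeasurableSpace Ω] {μ : Measure Ω}

theorem measureReal_Ioc_inter_le {X Y : Ω → ℝ} (h : IndepFun X Y μ) (a b c : ℝ) :
    μ.real {ω | Y ω ∈ Set.Ioc a b ∧ X ω ≤ c} =
      μ.real {ω | Y ω ∈ Set.Ioc a b} * μ.real {ω | X ω ≤ c} := by
  have := h.symm.measure_inter_preimage_eq_mul (Set.Ioc a b) (Set.Iic c) measurableSet_Ioc
    measurableSet_Iic
  simp only [Measure.real, ← ENNReal.toReal_mul]
  exact congrArg _ this

/-- At `x = 1` the ratio `F(t)/F(t)` tends to 1, whereas it would be 0 by convention wherever `F(t)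
= 0`. -/
theorem RegVaryingAtZero.eventually_pos {X : Ω → ℝ} {α : ℝ} (h : RegVaryingAtZero μ X α) :
    ∀ᶠ t in 𝓝[>] (0 : ℝ), 0 < μ.real {ω | X ω ≤ t} := by
  have h1 := h.2.2.2 1 one_pos
  rw [Real.one_rpow] at h1
  filter_upwards [h1.eventually_ne one_ne_zero] with t ht
  exact lt_of_le_of_ne measureReal_nonneg (div_ne_zero_iff.1 ht).2.symm

/-- Adds the endpoint `x = 0`, needed at the extreme points of the Riemann–Stieltjes sums; there
`F(0) = 0` and `0 ^ α = 0`. -/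
theorem RegVaryingAtZero.tendsto_of_nonneg {X : Ω → ℝ} {α : ℝ} (h : RegVaryingAtZero μ X α)
    {x : ℝ} (hx : 0 ≤ x) :
    Tendsto (fun t : ℝ => μ.real {ω | X ω ≤ t * x} / μ.real {ω | X ω ≤ t}) (𝓝[>] 0)
      (𝓝 (x ^ α)) := by
  rcases hx.eq_or_lt with rfl | hx
  · have : μ {ω | X ω ≤ 0} = 0 := by
      have := h.2.2.1
      rw [ae_iff] at this
      simpa using this
    simp [Measure.real, this, Real.zero_rpow h.1.ne']
  · exact h.2.2.2 x hx

variable [IsProbabilityMeasure μ]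

theorem measureReal_preimage_Ioc {Y : Ω → ℝ} (hY : Measurable Y) {a b : ℝ} (hab : a ≤ b) :
    μ.real {ω | Y ω ∈ Set.Ioc a b} = μ.real {ω | Y ω ≤ b} - μ.real {ω | Y ω ≤ a} := by
  have : {ω | Y ω ∈ Set.Ioc a b} = {ω | Y ω ≤ b} \ {ω | Y ω ≤ a} := by
    ext ω; simp [and_comm]
  have hsub : {ω | Y ω ≤ a} ⊆ {ω | Y ω ≤ b} := fun ω (h : Y ω ≤ a) => h.trans hab
  rw [this, measureReal_sdiff hsub (measurableSet_le hY measurable_const)]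

/-- Upper Riemann-Stieltjes sum for the distribution function of a sum. -/
theorem measureReal_add_le_sum {X Y : Ω → ℝ} (h : IndepFun X Y μ)
    (hX0 : ∀ᵐ ω ∂μ, 0 < X ω) (hY0 : ∀ᵐ ω ∂μ, 0 < Y ω) {t : ℝ} (ht : 0 < t) {N : ℕ} (hN : 0 < N) :
    μ.real {ω | X ω + Y ω ≤ t} ≤ ∑ k ∈ Finset.range N,
      μ.real {ω | Y ω ∈ Set.Ioc (t * (k / N : ℝ)) (t * ((k + 1 : ℕ) / N : ℝ))} *
        μ.real {ω | X ω ≤ t * (1 - k / N)} := by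
  have hN' : (0 : ℝ) < N := by exact_mod_cast hN
  simp_rw [← measureReal_Ioc_inter_le h]
  refine le_trans ?_ (measureReal_biUnion_finset_le _ _)
  refine ENNReal.toReal_mono (measure_ne_top _ _) (measure_mono_ae ?_)
  filter_upwards [hX0, hY0] with ω hx hy hω
  have hω : X ω + Y ω ≤ t := hω
  have hq : 0 < Y ω / t * N := by positivity
  have hq1 : Y ω / t * N ≤ N := by
    have : Y ω / t ≤ 1 := (div_le_one ht).2 (by linarith)
    nlinarith
  -- The cells are open on the left, so the cell containing `Y ω` has index `⌈N Y/t⌉ - 1`;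
  -- positivity of `Y` keeps the ceiling away from 0.
  obtain ⟨k, hk⟩ : ∃ k, ⌈Y ω / t * N⌉₊ = k + 1 :=
    Nat.exists_eq_succ_of_ne_zero (Nat.ceil_pos.2 hq).ne'
  have hkN : k + 1 ≤ N := hk ▸ Nat.ceil_le.2 hq1
  have hlo : (k : ℝ) < Y ω / t * N := Nat.lt_ceil.1 (by omega)
  have hhi : Y ω / t * N ≤ (k + 1 : ℕ) := hk ▸ Nat.le_ceil _
  have hlo' : t * (k / N : ℝ) < Y ω := by
    rw [← mul_div_assoc, div_lt_iff₀ hN']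
    rw [div_mul_eq_mul_div, lt_div_iff₀ ht] at hlo
    linarith
  have hhi' : Y ω ≤ t * ((k + 1 : ℕ) / N : ℝ) := by
    rw [← mul_div_assoc, le_div_iff₀ hN']
    rw [div_mul_eq_mul_div, div_le_iff₀ ht] at hhi
    linarith
  change ω ∈ (⋃ k ∈ Finset.range N, _ : Set Ω)
  refine Set.mem_biUnion (x := k) (Finset.mem_coe.2 (Finset.mem_range.2 (by omega)))
    ⟨⟨hlo', hhi'⟩, ?_⟩
  linarith

/-- Lower Riemann-Stieltjes sum for the distribution function of a sum. -/
theorem sum_le_measureReal_add {X Y : Ω → ℝ} (hX : Measurable X) (hY : Measurable Y)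
    (h : IndepFun X Y μ) {t : ℝ} (ht : 0 < t) (N : ℕ) :
    ∑ k ∈ Finset.range N,
      μ.real {ω | Y ω ∈ Set.Ioc (t * (k / N : ℝ)) (t * ((k + 1 : ℕ) / N : ℝ))} *
        μ.real {ω | X ω ≤ t * (1 - (k + 1 : ℕ) / N)} ≤ μ.real {ω | X ω + Y ω ≤ t} := by
  simp_rw [← measureReal_Ioc_inter_le h]
  have hmono : Monotone fun k : ℕ => t * (k / N : ℝ) := fun a b hab => by
    have : (a : ℝ) ≤ b := by exact_mod_cast hab
    dsimp only
    gcongr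
  rw [← measureReal_biUnion_finset]
  · refine measureReal_mono (Set.iUnion₂_subset fun k _ ω hω => ?_)
    have h1 := hω.1.2
    have h2 := hω.2
    show X ω + Y ω ≤ t
    linarith
  · intro a _ b _ hab
    refine Set.disjoint_left.2 fun ω h1 h2 => ?_
    exact Set.disjoint_left.1 (hmono.pairwise_disjoint_on_Ioc_succ hab) h1.1 h2.1
  · intro k _
    exact (hY measurableSet_Ioc).inter (hX measurableSet_Iic)

/-- After division by `F_X(t) F_Y(t)`, the upper and lower Riemann–Stieltjes sums on a grid of mesh
`t/N` converge to sums for `∫ (1 - s)^α d(s^β)` over `[0, 1]`. These two limits are close for large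
`N`, so the ratio converges; the value of the integral is never needed, only that it is positive. -/
theorem RegVaryingAtZero.exists_tendsto_add {X Y : Ω → ℝ} {α β : ℝ}
    (hα : RegVaryingAtZero μ X α) (hβ : RegVaryingAtZero μ Y β)
    (hX : Measurable X) (hY : Measurable Y) (h : IndepFun X Y μ) :
    ∃ c, 0 < c ∧ Tendsto (fun t : ℝ => μ.real {ω | X ω + Y ω ≤ t} /
      (μ.real {ω | X ω ≤ t} * μ.real {ω | Y ω ≤ t})) (𝓝[>] 0) (𝓝 c) := by
  set R : ℝ → ℝ := fun t => μ.real {ω | X ω + Y ω ≤ t} /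
      (μ.real {ω | X ω ≤ t} * μ.real {ω | Y ω ≤ t}) with hR
  have key : ∀ (N : ℕ) (r : ℕ → ℝ), (∀ k < N, 0 ≤ r k) →
      Tendsto (fun t : ℝ => (∑ k ∈ Finset.range N,
        μ.real {ω | Y ω ∈ Set.Ioc (t * (k / N : ℝ)) (t * ((k + 1 : ℕ) / N : ℝ))} *
        μ.real {ω | X ω ≤ t * r k}) / (μ.real {ω | X ω ≤ t} * μ.real {ω | Y ω ≤ t}))
      (𝓝[>] 0) (𝓝 (∑ k ∈ Finset.range N,
        ((((k + 1 : ℕ) / N : ℝ)) ^ β - (k / N : ℝ) ^ β) * (r k) ^ α)) := by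
    intro N r hr
    have := tendsto_finsetSum (Finset.range N) (fun k hk =>
      ((hβ.tendsto_of_nonneg (x := ((k + 1 : ℕ) / N : ℝ)) (by positivity)).sub
        (hβ.tendsto_of_nonneg (x := (k / N : ℝ)) (by positivity))).mul
        (hα.tendsto_of_nonneg (hr k (Finset.mem_range.1 hk))))
    refine this.congr' ?_
    filter_upwards [self_mem_nhdsWithin] with t ht
    have ht : 0 < t := ht
    rw [Finset.sum_div]
    refine Finset.sum_congr rfl fun k _ => ?_
    rw [measureReal_preimage_Ioc hY (by gcongr; simp), ← sub_div, div_mul_div_comm,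
      mul_comm (μ.real {ω | Y ω ≤ t})]
  have lower : ∀ N : ℕ, 0 < N → ∀ a, a < ∑ k ∈ Finset.range N,
      ((((k + 1 : ℕ) / N : ℝ)) ^ β - (k / N : ℝ) ^ β) * (1 - (k + 1 : ℕ) / N : ℝ) ^ α →
      ∀ᶠ t in 𝓝[>] 0, a ≤ R t := by
    intro N hN a ha
    have hr : ∀ k < N, 0 ≤ (1 - (k + 1 : ℕ) / N : ℝ) := fun k hk => by
      rw [sub_nonneg, div_le_one (by exact_mod_cast hN)]
      exact_mod_cast hk
    filter_upwards [(key N _ hr).eventually_const_lt ha, self_mem_nhdsWithin] with t h1 ht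
    refine h1.le.trans ?_
    exact div_le_div_of_nonneg_right (sum_le_measureReal_add hX hY h ht N) (by positivity)
  have upper : ∀ N : ℕ, 0 < N → ∀ a, ∑ k ∈ Finset.range N,
      ((((k + 1 : ℕ) / N : ℝ)) ^ β - (k / N : ℝ) ^ β) * (1 - k / N : ℝ) ^ α < a →
      ∀ᶠ t in 𝓝[>] 0, R t ≤ a := by
    intro N hN a ha
    have hr : ∀ k < N, 0 ≤ (1 - k / N : ℝ) := fun k hk => by
      rw [sub_nonneg, div_le_one (by exact_mod_cast hN)]
      exact_mod_cast hk.le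
    filter_upwards [(key N _ hr).eventually_lt_const ha, self_mem_nhdsWithin] with t h1 ht
    refine le_trans ?_ h1.le
    exact div_le_div_of_nonneg_right (measureReal_add_le_sum h hα.2.2.1 hβ.2.2.1 ht hN)
      (by positivity)
  obtain ⟨c, hc⟩ : ∃ c, Tendsto R (𝓝[>] 0) (𝓝 c) := by
    refine exists_tendsto_of_forall_eventually_mem_Icc fun δ hδ => ?_
    -- Uniform continuity of `x ^ α` makes each pair of summands differ by at most `δ/4` times an
    -- increment of `s ^ β`, and the increments telescope to 1. A further margin of `δ/4` on each
    -- side leaves a total width of at most `3δ/4`.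
    have huc : UniformContinuousOn (fun x : ℝ => x ^ α) (Set.Icc 0 1) :=
      isCompact_Icc.uniformContinuousOn_of_continuous
        (Real.continuous_rpow_const hα.1.le).continuousOn
    obtain ⟨ρ, hρ, huc⟩ := Metric.uniformContinuousOn_iff.1 huc (δ / 4) (by positivity)
    obtain ⟨n, hn⟩ := exists_nat_one_div_lt hρ
    set N := n + 1
    have hN : (0 : ℝ) < N := by positivity
    set l := ∑ k ∈ Finset.range N,
      ((((k + 1 : ℕ) / N : ℝ)) ^ β - (k / N : ℝ) ^ β) * (1 - (k + 1 : ℕ) / N : ℝ) ^ α with hl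
    set u := ∑ k ∈ Finset.range N,
      ((((k + 1 : ℕ) / N : ℝ)) ^ β - (k / N : ℝ) ^ β) * (1 - k / N : ℝ) ^ α with hu
    have hul : u - l ≤ δ / 4 := by
      rw [hu, hl, ← Finset.sum_sub_distrib]
      calc _ ≤ ∑ k ∈ Finset.range N,
            ((((k + 1 : ℕ) / N : ℝ)) ^ β - (k / N : ℝ) ^ β) * (δ / 4) := by
            refine Finset.sum_le_sum fun k hk => ?_
            have hk : k + 1 ≤ N := Finset.mem_range.1 hk
            have hk' : ((k + 1 : ℕ) / N : ℝ) ≤ 1 := (div_le_one hN).2 (by exact_mod_cast hk)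
            have hkk : (k / N : ℝ) ≤ ((k + 1 : ℕ) / N : ℝ) := by gcongr; simp
            have h0 : (0 : ℝ) ≤ k / N := by positivity
            rw [← mul_sub]
            refine mul_le_mul_of_nonneg_left ?_
              (sub_nonneg.2 (Real.rpow_le_rpow h0 hkk hβ.1.le))
            refine (le_abs_self _).trans ?_
            rw [← Real.dist_eq]
            refine (huc _ ⟨by linarith, by linarith⟩ _ ⟨by linarith, by linarith⟩ ?_).le
            rw [Real.dist_eq]
            have : (1 - k / N : ℝ) - (1 - (k + 1 : ℕ) / N) = 1 / N := by
              push_cast; field_simp; ring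
            rw [this, abs_of_pos (by positivity)]
            simpa [N] using hn
        _ = δ / 4 := by
            rw [← Finset.sum_mul, Finset.sum_range_sub (fun k : ℕ => (k / N : ℝ) ^ β)]
            simp [hN.ne', Real.zero_rpow hβ.1.ne']
    refine ⟨l - δ / 4, u + δ / 4, by linarith, ?_⟩
    filter_upwards [lower N (Nat.succ_pos n) (l - δ / 4) (by linarith),
      upper N (Nat.succ_pos n) (u + δ / 4) (by linarith)] with t h1 h2
    exact ⟨h1, h2⟩
  refine ⟨c, ?_, hc⟩
  -- This is the limiting lower sum for `N = 2`: only the cell `k = 0` contributes. It is halved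
  -- because `lower` requires a strict inequality.
  have hpos : (0 : ℝ) < (1 / 2 : ℝ) ^ β * (1 / 2 : ℝ) ^ α := by positivity
  refine lt_of_lt_of_le (half_pos hpos) (ge_of_tendsto hc (lower 2 two_pos _ ?_))
  norm_num [Finset.sum_range_succ, Real.zero_rpow hβ.1.ne', Real.zero_rpow hα.1.ne']
  norm_num at hpos
  linarith

theorem RegVaryingAtZero.add {X Y : Ω → ℝ} {α β : ℝ}
    (hα : RegVaryingAtZero μ X α) (hβ : RegVaryingAtZero μ Y β)
    (hX : Measurable X) (hY : Measurable Y) (h : IndepFun X Y μ) :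
    RegVaryingAtZero μ (fun ω => X ω + Y ω) (α + β) := by
  obtain ⟨c, hc, hlim⟩ := hα.exists_tendsto_add hβ hX hY h
  refine ⟨add_pos hα.1 hβ.1, (hX.add hY).aemeasurable, ?_, fun x hx => ?_⟩
  · filter_upwards [hα.2.2.1, hβ.2.2.1] with ω h1 h2 using add_pos h1 h2
  · refine tendsto_div_of_tendsto_ratio hx hc.ne' hlim ?_
    rw [Real.rpow_add hx]
    refine ((hα.2.2.2 x hx).mul (hβ.2.2.2 x hx)).congr fun t => ?_
    rw [div_mul_div_comm]

theorem RegVaryingAtZero.sum {ι : Type*} {X : ι → Ω → ℝ} {α : ℝ}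
    (hα : ∀ k, RegVaryingAtZero μ (X k) α) (hX : ∀ k, Measurable (X k)) (h : iIndepFun X μ)
    {S : Finset ι} (hS : S.Nonempty) :
    RegVaryingAtZero μ (fun ω => ∑ k ∈ S, X k ω) (S.card * α) := by
  classical
  induction hS using Finset.Nonempty.cons_induction with
  | singleton a => simpa using hα a
  | cons a s ha hs ih =>
    have hi : IndepFun (X a) (fun ω => ∑ k ∈ s, X k ω) μ := by
      have := (h.indepFun_finsetSum_of_notMem hX ha).symm
      rwa [show (∑ j ∈ s, X j) = fun ω => ∑ k ∈ s, X k ω from by ext; simp] at this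
    have := (hα a).add ih (hX a) (Finset.measurable_sum s fun k _ => hX k) hi
    simp only [Finset.sum_cons, Finset.card_cons]
    convert this using 1
    push_cast; ring

end Convolution

/-! ### Paths in a finite acyclic digraph. -/

namespace DAG

variable {V : Type*} {D : DAG V}

theorem wellFounded_adj [Finite V] (D : DAG V) : WellFounded D.Adj := by
  have : Std.Irrefl (Relation.TransGen D.Adj) := ⟨D.acyclic⟩
  exact Subrelation.wf (fun h => Relation.TransGen.single h)
    (Finite.wellFounded_of_trans_of_irrefl (Relation.TransGen D.Adj))

theorem wellFounded_swap_adj [Finite V] (D : DAG V) : WellFounded (Function.swap D.Adj) := by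
  have : Std.Irrefl (Relation.TransGen (Function.swap D.Adj)) :=
    ⟨fun v h => D.acyclic v (Relation.transGen_swap.1 h)⟩
  exact Subrelation.wf (fun h => Relation.TransGen.single h)
    (Finite.wellFounded_of_trans_of_irrefl (Relation.TransGen (Function.swap D.Adj)))

namespace Path

theorem transGen {j i : V} (p : D.Path j i) : Relation.TransGen D.Adj j i := by
  induction p with
  | edge h => exact .single h
  | cons h _ ih => exact .head h ih

theorem ne {j i : V} (p : D.Path j i) : j ≠ i := by
  rintro rfl
  exact D.acyclic j p.transGen

/-- Append an edge at the end of a path. -/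
def snoc : {j k i : V} → D.Path j k → D.Adj k i → D.Path j i
  | _, _, _, edge h, h' => cons h (edge h')
  | _, _, _, cons h p, h' => cons h (p.snoc h')

theorem weight_snoc (C : V → V → ℝ) {j k i : V} (p : D.Path j k) (h : D.Adj k i) :
    (p.snoc h).weight C = p.weight C * C k i := by
  induction p with
  | edge h => rfl
  | cons h' p ih => simp only [snoc, weight, ih, mul_assoc]

theorem weight_pos {C : V → V → ℝ} (hC : ∀ j i, D.Adj j i → 0 < C j i) {j i : V}
    (p : D.Path j i) : 0 < p.weight C := by
  induction p with
  | edge h => exact hC _ _ h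
  | cons h p ih => exact mul_pos (hC _ _ h) ih

theorem transGen_of_mem_nodeSet [DecidableEq V] {j i k : V} (p : D.Path j i)
    (hk : k ∈ p.nodeSet) : Relation.TransGen D.Adj j k := by
  induction p with
  | edge h =>
    rw [nodeSet, Finset.mem_singleton] at hk
    exact hk ▸ .single h
  | cons h p ih =>
    rw [nodeSet, Finset.mem_insert] at hk
    rcases hk with rfl | hk
    · exact .single h
    · exact .head h (ih hk)

theorem nodeSet_nonempty [DecidableEq V] {j i : V} (p : D.Path j i) : p.nodeSet.Nonempty := by
  cases p with
  | edge h => exact Finset.singleton_nonempty _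
  | cons h p => exact Finset.insert_nonempty _ _

/-- Acyclicity prevents a path from revisiting a node, so the product over the finite set `nodeSet`
counts each noise factor along the path exactly once. -/
theorem weight_mul_noise [DecidableEq V] (C : V → V → ℝ) (e : V → ℝ) {j i : V} (p : D.Path j i) :
    p.weight (fun k l => C k l * e l) = p.weight C * ∏ k ∈ p.nodeSet, e k := by
  induction p with
  | edge h => simp [weight, nodeSet]
  | cons h p ih =>
    rw [nodeSet, Finset.prod_insert fun hk => D.acyclic _ (p.transGen_of_mem_nodeSet hk),
      weight, weight, ih]
    ring

/-- Well-founded induction on the initial node, splitting off the first edge. Finiteness ensures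
that the supremum defining `mlCoeff` is bounded. -/
instance instFinite [Finite V] (j i : V) : Finite (D.Path j i) := by
  refine D.wellFounded_swap_adj.induction (C := fun j => Finite (D.Path j i)) j fun j ih => ?_
  have : ∀ k : {k // D.Adj j k}, Finite (D.Path k i) := fun k => ih k k.2
  refine Finite.of_surjective
    (fun x : PLift (D.Adj j i) ⊕ (Σ k : {k // D.Adj j k}, D.Path k i) =>
      (match x with
        | .inl h => edge h.down
        | .inr y => cons y.1.2 y.2 : D.Path j i)) fun p => ?_
  cases p with
  | edge h => exact ⟨.inl ⟨h⟩, rfl⟩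
  | cons h p => exact ⟨.inr ⟨⟨_, h⟩, p⟩, rfl⟩

theorem weight_le_mlCoeff [Finite V] [DecidableEq V] (C : V → V → ℝ) {j i : V} (p : D.Path j i) :
    p.weight C ≤ D.mlCoeff C j i := by
  rw [mlCoeff, if_neg p.ne]
  exact le_ciSup (f := fun q : D.Path j i => q.weight C) (Set.finite_range _).bddAbove p

end Path

/-! ### The recursion for fixed innovations and noise. -/

/-- `u` solves the recursive max-linear equations with innovations `z` and noise `e`. -/
def IsSolution (D : DAG V) (C : V → V → ℝ) (z e u : V → ℝ) : Prop :=
  ∀ i, u i = ((⨆ k : {k : V // D.Adj k i}, C k i * u k) ⊔ z i) * e i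

/-- The solution of the recursive max-linear equations. -/
noncomputable def solution [Finite V] (D : DAG V) (C : V → V → ℝ) (z e : V → ℝ) : V → ℝ :=
  D.wellFounded_adj.fix fun i u =>
    ((⨆ k : {k : V // D.Adj k i}, C k i * u k k.2) ⊔ z i) * e i

variable {C : V → V → ℝ} {z e e' u u' : V → ℝ}

theorem IsSolution.pos (h : D.IsSolution C z e u) (hz : ∀ i, 0 < z i) (he : ∀ i, 0 < e i) (i : V) :
    0 < u i := by
  rw [h i]
  exact mul_pos (lt_max_of_lt_right (hz i)) (he i)

theorem IsSolution.innovation_mul_le (h : D.IsSolution C z e u) (he : ∀ i, 0 < e i) (i : V) :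
    z i * e i ≤ u i := by
  rw [h i]
  exact mul_le_mul_of_nonneg_right le_sup_right (he i).le

variable [Finite V]

theorem isSolution_solution (D : DAG V) (C : V → V → ℝ) (z e : V → ℝ) :
    D.IsSolution C z e (D.solution C z e) := fun i => by
  rw [solution, WellFounded.fix_eq]

/-- Allows the solution with noise switched off to be treated as a measurable function of the
remaining randomness, as the independence argument requires. -/
theorem measurable_solution (D : DAG V) (C : V → V → ℝ) (i : V) :
    Measurable fun x : (V → ℝ) × (V → ℝ) => D.solution C x.1 x.2 i := by
  refine D.wellFounded_adj.induction
    (C := fun i => Measurable fun x : (V → ℝ) × (V → ℝ) => D.solution C x.1 x.2 i) i fun i ih => ?_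
  simp_rw [fun x : (V → ℝ) × (V → ℝ) => D.isSolution_solution C x.1 x.2 i]
  refine Measurable.mul (Measurable.max (Measurable.iSup fun k => ?_) ?_) ?_
  · exact (ih k k.2).const_mul _
  · exact (measurable_pi_apply i).comp measurable_fst
  · exact (measurable_pi_apply i).comp measurable_snd

namespace IsSolution

theorem edge_le (h : D.IsSolution C z e u) (he : ∀ i, 0 < e i) {k i : V} (hk : D.Adj k i) :
    C k i * e i * u k ≤ u i := by
  rw [h i, mul_right_comm]
  refine mul_le_mul_of_nonneg_right (le_sup_of_le_left ?_) (he i).le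
  exact le_ciSup (f := fun k : {k : V // D.Adj k i} => C k i * u k)
    (Set.finite_range _).bddAbove ⟨k, hk⟩

theorem path_le (h : D.IsSolution C z e u) (hC : ∀ j i, D.Adj j i → 0 < C j i)
    (he : ∀ i, 0 < e i) {j i : V} (p : D.Path j i) :
    p.weight (fun k l => C k l * e l) * u j ≤ u i := by
  induction p with
  | edge hk => exact h.edge_le he hk
  | cons hk p ih =>
    refine le_trans ?_ ih
    rw [Path.weight, mul_comm (_ * _) (p.weight _), mul_assoc]
    exact mul_le_mul_of_nonneg_left (h.edge_le he hk)
      (Path.weight_pos (fun k l hkl => mul_pos (hC k l hkl) (he l)) p).le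

theorem mono (h : D.IsSolution C z e u) (h' : D.IsSolution C z e' u')
    (hC : ∀ j i, D.Adj j i → 0 < C j i) (hz : ∀ i, 0 < z i) (he' : ∀ i, 0 < e' i)
    (hee : ∀ i, e' i ≤ e i) (i : V) : u' i ≤ u i := by
  refine D.wellFounded_adj.induction (C := fun i => u' i ≤ u i) i fun i ih => ?_
  rw [h i, h' i]
  refine mul_le_mul (sup_le_sup_right (ciSup_mono (Set.finite_range _).bddAbove fun k => ?_) _)
    (hee i) (he' i).le ((hz i).le.trans le_sup_right)
  exact mul_le_mul_of_nonneg_left (ih k k.2) (hC k i k.2).le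

open Classical in
/-- Removing the noise on `S` divides the solution at `i` at most by the product of the noise over
the nodes of `S` from which `i` can be reached. -/
theorem le_prod_mul [DecidableEq V] (h : D.IsSolution C z e u) {S : Finset V}
    (h' : D.IsSolution C z (fun k => if k ∈ S then 1 else e k) u')
    (hC : ∀ j i, D.Adj j i → 0 < C j i) (hz : ∀ i, 0 < z i) (he : ∀ i, 1 ≤ e i) (i : V) :
    u i ≤ (∏ k ∈ S with Relation.ReflTransGen D.Adj k i, e k) * u' i := by
  have he0 : ∀ i, 0 < e i := fun i => zero_lt_one.trans_le (he i)
  have he1 : ∀ T : Finset V, 1 ≤ ∏ k ∈ T, e k := fun T => Finset.one_le_prod fun k _ => he k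
  have hu' : ∀ i, 0 < u' i := h'.pos hz fun i => by split_ifs <;> simp [he0]
  refine D.wellFounded_adj.induction
    (C := fun i => u i ≤ (∏ k ∈ S with Relation.ReflTransGen D.Adj k i, e k) * u' i) i
    fun i ih => ?_
  -- `P` collects the strict ancestors of `i` in `S`. The product bounding a parent is a subproduct
  -- of `P`, as all factors are at least 1; the factor at `i` itself is added only when `i ∈ S`.
  set P := ∏ k ∈ S with Relation.TransGen D.Adj k i, e k with hP
  have hP1 : 1 ≤ P := he1 _
  have hP0 : 0 < P := zero_lt_one.trans_le hP1
  have hsup : ((⨆ k : {k : V // D.Adj k i}, C k i * u k) ⊔ z i) ≤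
      P * ((⨆ k : {k : V // D.Adj k i}, C k i * u' k) ⊔ z i) := by
    -- The extra goal that the bound be nonnegative covers nodes without parents, where the supremum
    -- is 0.
    refine sup_le (Real.iSup_le (fun k => ?_) ?_) ?_
    · calc C k i * u k ≤ C k i * (P * u' k) := by
            refine mul_le_mul_of_nonneg_left ((ih k k.2).trans ?_) (hC k i k.2).le
            refine mul_le_mul_of_nonneg_right ?_ (hu' k).le
            refine Finset.prod_le_prod_of_subset_of_one_le ?_ ?_ ?_
            · intro l hl
              rw [Finset.mem_filter] at hl ⊢
              exact ⟨hl.1, .tail' hl.2 k.2⟩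
            · exact fun l _ => (he0 l).le
            · exact fun l _ _ => he l
        _ = P * (C k i * u' k) := by ring
        _ ≤ _ := by
            refine mul_le_mul_of_nonneg_left (le_sup_of_le_left ?_) hP0.le
            exact le_ciSup (f := fun k : {k : V // D.Adj k i} => C k i * u' k)
              (Set.finite_range _).bddAbove k
    · exact mul_nonneg hP0.le ((hz i).le.trans le_sup_right)
    · calc z i ≤ P * z i := le_mul_of_one_le_left (hz i).le hP1
        _ ≤ _ := mul_le_mul_of_nonneg_left le_sup_right hP0.le
  rw [h i, h' i, ← mul_assoc]
  beta_reduce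
  by_cases hi : i ∈ S
  · have : (S.filter fun k => Relation.ReflTransGen D.Adj k i) =
        insert i (S.filter fun k => Relation.TransGen D.Adj k i) := by
      ext k
      simp only [Finset.mem_filter, Finset.mem_insert, Relation.reflTransGen_iff_eq_or_transGen]
      constructor
      · rintro ⟨hk, rfl | h⟩
        exacts [.inl rfl, .inr ⟨hk, h⟩]
      · rintro (rfl | ⟨hk, h⟩)
        exacts [⟨hi, .inl rfl⟩, ⟨hk, .inr h⟩]
    rw [this, Finset.prod_insert (by simp [D.acyclic i]), ← hP, if_pos hi, mul_one, mul_assoc,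
      mul_comm (e i)]
    exact mul_le_mul_of_nonneg_right hsup (he0 i).le
  · have : (S.filter fun k => Relation.ReflTransGen D.Adj k i) =
        S.filter fun k => Relation.TransGen D.Adj k i := by
      refine Finset.filter_congr fun k hk => ?_
      rw [Relation.reflTransGen_iff_eq_or_transGen]
      refine ⟨?_, .inr⟩
      rintro (rfl | h)
      exacts [absurd hk hi, h]
    rw [this, ← hP, if_neg hi]
    exact mul_le_mul_of_nonneg_right hsup (he0 i).le

/-- The solution is attained along some path from an innovation. -/
theorem exists_path (h : D.IsSolution C z e u) (hz : ∀ i, 0 < z i) (i : V) :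
    u i = z i * e i ∨
      ∃ l, ∃ q : D.Path l i, u i = z l * e l * q.weight (fun k l => C k l * e l) := by
  refine D.wellFounded_adj.induction (C := fun i => u i = z i * e i ∨
    ∃ l, ∃ q : D.Path l i, u i = z l * e l * q.weight (fun k l => C k l * e l)) i fun i ih => ?_
  rcases le_total (⨆ k : {k : V // D.Adj k i}, C k i * u k) (z i) with hle | hle
  · left
    rw [h i, sup_eq_right.2 hle]
  · right
    -- Without parents the supremum would be 0, contradicting `0 < z i ≤ 0`.
    have hne : Nonempty {k : V // D.Adj k i} := by
      by_contra hne
      rw [not_nonempty_iff] at hne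
      rw [Real.iSup_of_isEmpty] at hle
      exact absurd hle (hz i).not_ge
    obtain ⟨k, hk⟩ := exists_eq_ciSup_of_finite (f := fun k : {k : V // D.Adj k i} => C k i * u k)
    have hui : u i = C k i * u k * e i := by rw [h i, sup_eq_left.2 hle, ← hk]
    rcases ih k k.2 with hk' | ⟨l, q, hq⟩
    · exact ⟨k, .edge k.2, by rw [hui, hk', Path.weight]; ring⟩
    · exact ⟨l, q.snoc k.2, by rw [hui, hq, Path.weight_snoc]; ring⟩

end IsSolution

/-! ### Genericity: an event on which `p` dominates. -/

/-- If `p` is generic, its noise is switched off, all other noise is close to `1` and the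
innovation at the initial node dominates the others, then `p` realises the solution at its terminal
node. -/
theorem Path.IsGeneric.exists_le [DecidableEq V] (hC : ∀ j i, D.Adj j i → 0 < C j i) {j i : V}
    {p : D.Path j i} (hp : p.IsGeneric C) :
    ∃ δ > 0, ∃ η > 0, ∀ z e u : V → ℝ, (∀ k, 0 < z k) → 1 < z j → (∀ l ≠ j, z l < η) →
      (∀ k, 1 ≤ e k) → (∀ k, e k ≤ 1 + δ) → (∀ k ∈ p.nodeSet, e k = 1) → D.IsSolution C z e u →
      u i ≤ D.mlCoeff C j i * u j := by
  have hb : 0 < D.mlCoeff C j i := hp.1 ▸ p.weight_pos hC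
  have := Fintype.ofFinite V
  -- At `δ = 0` the inequality is strict by genericity, and there are finitely many paths, so it
  -- persists for small `δ`. The power `card V` bounds the noise collected along any path.
  obtain ⟨δ, hδ, hδ0⟩ : ∃ δ : ℝ, (∀ q : D.Path j i, q ≠ p →
      q.weight C * (1 + δ) ^ Fintype.card V < D.mlCoeff C j i) ∧ 0 < δ := by
    have hev : ∀ᶠ δ : ℝ in 𝓝[>] 0, ∀ q : D.Path j i, q ≠ p →
        q.weight C * (1 + δ) ^ Fintype.card V < D.mlCoeff C j i := by
      refine eventually_all.2 fun q => ?_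
      by_cases hq : q = p
      · exact Eventually.of_forall fun _ h => absurd hq h
      have hlt : q.weight C < D.mlCoeff C j i :=
        lt_of_le_of_ne (q.weight_le_mlCoeff C) fun h => hq (hp.2 q h)
      have hc : Tendsto (fun δ : ℝ => q.weight C * (1 + δ) ^ Fintype.card V) (𝓝 0)
          (𝓝 (q.weight C * (1 + 0) ^ Fintype.card V)) :=
        (by fun_prop : Continuous fun δ : ℝ => q.weight C * (1 + δ) ^ Fintype.card V).tendsto 0
      simp only [add_zero, one_pow, mul_one] at hc
      filter_upwards [(hc.mono_left nhdsWithin_le_nhds).eventually_lt_const hlt] with δ h _ using h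
    exact (hev.and self_mem_nhdsWithin).exists
  have hδ1 : (0 : ℝ) < 1 + δ := by positivity
  -- Every left-hand side tends to 0 with `η`. The first condition controls the innovation at `i`
  -- itself, the second an innovation carried to `i` along any path.
  obtain ⟨η, ⟨hη1, hη⟩, hη0⟩ : ∃ η : ℝ, (η * (1 + δ) < D.mlCoeff C j i ∧
      ∀ x : Σ l, D.Path l i, η * (1 + δ) * (x.2.weight C * (1 + δ) ^ Fintype.card V) <
        D.mlCoeff C j i) ∧ 0 < η := by
    have hlim : ∀ a : ℝ, ∀ᶠ η : ℝ in 𝓝[>] 0, η * (1 + δ) * a < D.mlCoeff C j i := fun a => by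
      have hc : Tendsto (fun η : ℝ => η * (1 + δ) * a) (𝓝 0) (𝓝 (0 * (1 + δ) * a)) :=
        (by fun_prop : Continuous fun η : ℝ => η * (1 + δ) * a).tendsto 0
      simp only [zero_mul] at hc
      exact (hc.mono_left nhdsWithin_le_nhds).eventually_lt_const hb
    refine (((hlim 1).mono fun η h => ?_).and (eventually_all.2 fun x => hlim _)
      |>.and self_mem_nhdsWithin).exists
    simpa using h
  refine ⟨δ, hδ0, η, hη0, fun z e u hz hzj hzl he1 heδ hep hu => ?_⟩
  have he0 : ∀ k, 0 < e k := fun k => zero_lt_one.trans_le (he1 k)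
  have huj : z j * e j ≤ u j := hu.innovation_mul_le he0 j
  have huj1 : 1 ≤ u j := huj.trans' (one_le_mul_of_one_le_of_one_le hzj.le (he1 j))
  -- Since `u j ≥ 1`, a contribution not starting at `j` need only stay below `b_{ji}`.
  have hbu : D.mlCoeff C j i ≤ D.mlCoeff C j i * u j := le_mul_of_one_le_right hb.le huj1
  have hprod : ∀ T : Finset V, ∏ k ∈ T, e k ≤ (1 + δ) ^ Fintype.card V := fun T => by
    calc ∏ k ∈ T, e k ≤ ∏ k ∈ T, (1 + δ) := Finset.prod_le_prod (fun k _ => (he0 k).le)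
          fun k _ => heδ k
      _ = (1 + δ) ^ T.card := by simp
      _ ≤ _ := pow_le_pow_right₀ (by linarith) (Finset.card_le_univ T)
  have hwt : ∀ {l : V} (q : D.Path l i), q.weight (fun k l => C k l * e l) ≤
      q.weight C * (1 + δ) ^ Fintype.card V := fun q => by
    rw [q.weight_mul_noise]
    exact mul_le_mul_of_nonneg_left (hprod _) (q.weight_pos hC).le
  have hzη : ∀ l ≠ j, z l * e l ≤ η * (1 + δ) := fun l hl =>
    mul_le_mul (hzl l hl).le (heδ l) (he0 l).le hη0.le
  rcases hu.exists_path hz i with h | ⟨l, q, h⟩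
  · rw [h]
    exact ((hzη i p.ne.symm).trans hη1.le).trans hbu
  · by_cases hl : l = j
    · subst hl
      -- With its noise off, `p` has weight exactly `b_{ji}`; every other path from `j` stays below
      -- it by the choice of `δ`.
      have hq : q.weight (fun k l => C k l * e l) ≤ D.mlCoeff C l i := by
        by_cases hqp : q = p
        · rw [q.weight_mul_noise, hqp, Finset.prod_eq_one hep, mul_one, hp.1]
        · exact (hwt q).trans (hδ q hqp).le
      rw [h, mul_comm]
      exact mul_le_mul hq huj (mul_pos (hz l) (he0 l)).le hb.le
    · refine le_trans ?_ hbu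
      rw [h]
      refine le_trans ?_ (hη ⟨l, q⟩).le
      exact mul_le_mul (hzη l hl) (hwt q)
        (q.weight_pos fun k l hkl => mul_pos (hC k l hkl) (he0 l)).le (by positivity)

end DAG

/-! ### Independence and the squeeze argument. -/

section Probability

variable {Ω : Type*} [MeasurableSpace Ω] {μ : Measure Ω}

theorem iIndepFun.measure_forall_pos {ι : Type*} [Finite ι] {X : ι → Ω → ℝ} (h : iIndepFun X μ)
    {A : ι → Set ℝ} (hA : ∀ i, MeasurableSet (A i)) (hpos : ∀ i, 0 < μ (X i ⁻¹' A i)) :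
    0 < μ {ω | ∀ i, X i ω ∈ A i} := by
  have := Fintype.ofFinite ι
  have h1 := h.measure_inter_preimage_eq_mul Finset.univ (sets := A) fun i _ => hA i
  have h2 : {ω | ∀ i, X i ω ∈ A i} = ⋂ i ∈ Finset.univ, X i ⁻¹' A i := by ext; simp
  rw [h2, h1]
  exact CanonicallyOrderedAdd.prod_pos.2 fun i _ => hpos i

/-- If `log ε` is regularly varying at zero, then `ε` charges every right neighbourhood of `1`. -/
theorem RegVaryingAtZero.measure_le_one_add_pos {ε : Ω → ℝ} {α δ : ℝ}
    (h : RegVaryingAtZero μ (fun ω => Real.log (ε ω)) α) (h1 : ∀ᵐ ω ∂μ, 1 ≤ ε ω) (hδ : 0 < δ) :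
    0 < μ {ω | ε ω ≤ 1 + δ} := by
  have hlog : 0 < Real.log (1 + δ) := Real.log_pos (by linarith)
  obtain ⟨t, ht, htδ⟩ := (h.eventually_pos.and (Ioc_mem_nhdsGT hlog)).exists
  refine lt_of_lt_of_le ((ENNReal.toReal_pos_iff.1 ht).1) (measure_mono_ae ?_)
  filter_upwards [h1] with ω hω (hle : Real.log (ε ω) ≤ t)
  exact (Real.log_le_log_iff (by linarith) (by linarith)).1 (hle.trans htδ.2)

variable [IsProbabilityMeasure μ]

/-- Associativity of product measures: both sides express that the joint law is the threefold
product of the marginals. -/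
theorem indepFun_prodMk_of_indepFun_prodMk {β γ δ : Type*} [MeasurableSpace β] [MeasurableSpace γ]
    [MeasurableSpace δ] {X : Ω → β} {Y : Ω → γ} {Z : Ω → δ} (hX : Measurable X)
    (hY : Measurable Y) (hZ : Measurable Z) (hXY : IndepFun X Y μ)
    (hXYZ : IndepFun (fun ω => (X ω, Y ω)) Z μ) :
    IndepFun X (fun ω => (Y ω, Z ω)) μ := by
  have := Measure.isProbabilityMeasure_map (μ := μ) hX.aemeasurable
  have := Measure.isProbabilityMeasure_map (μ := μ) hY.aemeasurable
  have := Measure.isProbabilityMeasure_map (μ := μ) hZ.aemeasurable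
  have hYZ : IndepFun Y Z μ := hXYZ.comp measurable_snd measurable_id
  rw [indepFun_iff_map_prod_eq_prod_map_map (by fun_prop) (by fun_prop)] at hXY hXYZ hYZ ⊢
  rw [hYZ, ← Measure.prodAssoc_prod, ← hXY, ← hXYZ,
    Measure.map_map MeasurableEquiv.prodAssoc.measurable ((hX.prodMk hY).prodMk hZ)]
  rfl

theorem tendsto_measureReal_le_nhdsGT {Y : Ω → ℝ} (hY : Measurable Y) (a : ℝ) :
    Tendsto (fun t : ℝ => μ.real {ω | Y ω ≤ t}) (𝓝[>] a) (𝓝 (μ.real {ω | Y ω ≤ a})) := by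
  have h := tendsto_measure_biInter_gt (μ := μ) (s := fun t : ℝ => {ω | Y ω ≤ t}) (a := a)
    (fun t _ => (measurableSet_le hY measurable_const).nullMeasurableSet)
    (fun s t _ hst ω (hω : Y ω ≤ s) => hω.trans hst) ⟨a + 1, by simp, measure_ne_top _ _⟩
  have hs : (⋂ r > a, {ω | Y ω ≤ r}) = {ω | Y ω ≤ a} := by
    ext ω
    simp only [Set.mem_iInter, Set.mem_ofPred_eq]
    exact ⟨fun H => le_of_forall_gt_imp_ge_of_dense H, fun H r hr => H.trans hr.le⟩
  rw [hs] at h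
  exact (ENNReal.tendsto_toReal (measure_ne_top _ _)).comp h

/-- If `Y` lies between `W ⊔ Y₀` and `W + Y₀` with `Y₀` independent of the regularly varying `W`
and not almost surely positive, then `Y` is regularly varying with the same exponent. -/
theorem RegVaryingAtZero.of_squeeze {W Y Y₀ : Ω → ℝ} {γ : ℝ} (hW : RegVaryingAtZero μ W γ)
    (hY : Measurable Y) (hY₀ : Measurable Y₀)
    (hind : IndepFun W Y₀ μ) (hpos : 0 < μ {ω | Y₀ ω ≤ 0})
    (h : ∀ᵐ ω ∂μ, W ω ≤ Y ω ∧ Y₀ ω ≤ Y ω ∧ Y ω ≤ W ω + Y₀ ω) :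
    RegVaryingAtZero μ Y γ := by
  have hprod : ∀ s t : ℝ, μ.real {ω | W ω ≤ s ∧ Y₀ ω ≤ t} =
      μ.real {ω | W ω ≤ s} * μ.real {ω | Y₀ ω ≤ t} := fun s t => by
    simp only [Measure.real, ← ENNReal.toReal_mul]
    exact congrArg _ (hind.measure_inter_preimage_eq_mul (Set.Iic s) (Set.Iic t) measurableSet_Iic
      measurableSet_Iic)
  have hc : 0 < μ.real {ω | Y₀ ω ≤ 0} := ENNReal.toReal_pos hpos.ne' (measure_ne_top _ _)
  refine ⟨hW.1, hY.aemeasurable, ?_, fun x hx => ?_⟩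
  · filter_upwards [hW.2.2.1, h] with ω h1 h2 using h1.trans_le h2.1
  refine tendsto_div_of_tendsto_ratio (f := fun t => μ.real {ω | Y ω ≤ t})
    (g := fun t => μ.real {ω | W ω ≤ t}) hx hc.ne' ?_ (hW.2.2.2 x hx)
  refine tendsto_of_tendsto_of_tendsto_of_le_of_le' tendsto_const_nhds
    (tendsto_measureReal_le_nhdsGT hY₀ 0) ?_ ?_
  -- Lower bound: `W ≤ t` and `Y₀ ≤ 0` force `Y ≤ W + Y₀ ≤ t`.
  · filter_upwards [hW.eventually_pos] with t ht
    rw [le_div_iff₀ ht, mul_comm, ← hprod]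
    refine ENNReal.toReal_mono (measure_ne_top _ _) (measure_mono_ae ?_)
    filter_upwards [h] with ω h1 (h2 : W ω ≤ t ∧ Y₀ ω ≤ 0)
    show Y ω ≤ t
    linarith [h2.1, h2.2]
  -- Upper bound: `Y ≤ t` forces both `W ≤ t` and `Y₀ ≤ t`.
  · filter_upwards [hW.eventually_pos] with t ht
    rw [div_le_iff₀ ht, mul_comm, ← hprod]
    refine ENNReal.toReal_mono (measure_ne_top _ _) (measure_mono_ae ?_)
    filter_upwards [h] with ω h1 (h2 : Y ω ≤ t)
    exact ⟨h1.1.trans h2, h1.2.1.trans h2⟩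

end Probability

/-! ### The random recursion and the main theorem. -/

namespace DAG.IsRecursiveMLNoise

variable {V Ω : Type*} [DecidableEq V] [MeasurableSpace Ω] {μ : Measure Ω}
  {D : DAG V} {C : V → V → ℝ} {Z ε U : V → Ω → ℝ} {j i : V}

/-- Separation of the noise along a path `p` from the remaining randomness: with `W` the total
logarithmic noise along `p` and `Y₀` the normalised log-ratio obtained by switching that noise off,
the normalised log-ratio lies between `W ⊔ Y₀` and `W + Y₀`. -/
theorem ae_log_ratio_bounds [Finite V] (hU : D.IsRecursiveMLNoise C μ Z ε U) (p : D.Path j i)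
    (hp : p.weight C = D.mlCoeff C j i) {U₀ : Ω → V → ℝ}
    (hU₀ : ∀ ω, D.IsSolution C (fun k => Z k ω)
      (fun k => if k ∈ p.nodeSet then 1 else ε k ω) (U₀ ω)) :
    ∀ᵐ ω ∂μ,
      ∑ k ∈ p.nodeSet, Real.log (ε k ω) ≤
        Real.log (U i ω / U j ω) - Real.log (D.mlCoeff C j i) ∧
      Real.log (U₀ ω i / U₀ ω j) - Real.log (D.mlCoeff C j i) ≤
        Real.log (U i ω / U j ω) - Real.log (D.mlCoeff C j i) ∧
      Real.log (U i ω / U j ω) - Real.log (D.mlCoeff C j i) ≤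
        ∑ k ∈ p.nodeSet, Real.log (ε k ω) +
          (Real.log (U₀ ω i / U₀ ω j) - Real.log (D.mlCoeff C j i)) := by
  classical
  have hC := hU.edgeWeight.1
  have hb : 0 < D.mlCoeff C j i := hp ▸ p.weight_pos hC
  filter_upwards [ae_all_iff.2 hU.Z_pos, ae_all_iff.2 hU.eps_one_le, ae_all_iff.2 hU.recursion]
    with ω hz he hrec
  have hsol : D.IsSolution C (fun k => Z k ω) (fun k => ε k ω) (fun k => U k ω) := hrec
  have he0 : ∀ k, 0 < ε k ω := fun k => zero_lt_one.trans_le (he k)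
  have he0' : ∀ k, 0 < if k ∈ p.nodeSet then 1 else ε k ω := fun k => by
    split_ifs <;> simp [he0]
  have hUpos := hsol.pos hz he0
  have hU₀pos := (hU₀ ω).pos hz he0'
  have hle : ∀ k, U₀ ω k ≤ U k ω := hsol.mono (hU₀ ω) hC hz he0' fun k => by
    split_ifs <;> simp [he]
  have hup := fun k => hsol.le_prod_mul (hU₀ ω) hC hz he k
  -- No node of `S_p` reaches `j`, as that would close a cycle; the product of removed noise at `j`
  -- is therefore empty.
  have hj : U₀ ω j = U j ω := by
    refine le_antisymm (hle j) ((hup j).trans_eq ?_)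
    rw [Finset.filter_false_of_mem, Finset.prod_empty, one_mul]
    intro k hk hkj
    exact D.acyclic j ((p.transGen_of_mem_nodeSet hk).trans_left hkj)
  set P := ∏ k ∈ p.nodeSet, ε k ω with hP
  have hP0 : 0 < P := Finset.prod_pos fun k _ => he0 k
  have hi : U i ω ≤ P * U₀ ω i := by
    refine (hup i).trans (mul_le_mul_of_nonneg_right ?_ (hU₀pos i).le)
    exact Finset.prod_le_prod_of_subset_of_one_le (Finset.filter_subset _ _)
      (fun k _ => (he0 k).le) fun k _ _ => he k
  have hpath : D.mlCoeff C j i * P * U j ω ≤ U i ω := by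
    have := hsol.path_le hC he0 p
    rwa [p.weight_mul_noise, hp] at this
  rw [← Real.log_prod fun k _ => (he0 k).ne', hj,
    Real.log_div (hUpos i).ne' (hUpos j).ne', Real.log_div (hU₀pos i).ne' (hUpos j).ne']
  have h1 := Real.log_le_log (mul_pos (mul_pos hb hP0) (hUpos j)) hpath
  rw [Real.log_mul (mul_pos hb hP0).ne' (hUpos j).ne', Real.log_mul hb.ne' hP0.ne'] at h1
  have h2 := Real.log_le_log (hU₀pos i) (hle i)
  have h3 := Real.log_le_log (hUpos i) hi
  rw [Real.log_mul hP0.ne' (hU₀pos i).ne'] at h3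
  refine ⟨?_, ?_, ?_⟩ <;> linarith

theorem indepFun_noise (hU : D.IsRecursiveMLNoise C μ Z ε U) [IsProbabilityMeasure μ]
    [Fintype V] (S : Finset V) :
    IndepFun (fun ω (k : S) => ε k ω)
      (fun ω => ((fun (k : (Sᶜ : Finset V)) => ε k ω), fun k => Z k ω)) μ := by
  have hε : ∀ T : Finset V, Measurable fun ω (k : T) => ε k ω := fun T =>
    measurable_pi_lambda _ fun k => hU.measurable_eps k
  refine indepFun_prodMk_of_indepFun_prodMk (hε S) (hε Sᶜ)
    (measurable_pi_lambda _ hU.measurable_Z)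
    (hU.eps_indep.indepFun_finset S Sᶜ disjoint_compl_right hU.measurable_eps) ?_
  refine hU.eps_indep_Z.comp
    (φ := fun e : V → ℝ => ((fun k : S => e k), fun k : (Sᶜ : Finset V) => e k))
    (Measurable.prodMk ?_ ?_) measurable_id <;>
  exact measurable_pi_lambda _ fun k => measurable_pi_apply _

/-- Provides the event on which `p` dominates. The support `[0, ∞)` permits both `Z_j > 1` and small
values of the others, regular variation of `ln ε_k` charges every right neighbourhood of 1, and
independence multiplies these probabilities. -/
theorem measure_innovation_noise_pos [Finite V] (hU : D.IsRecursiveMLNoise C μ Z ε U)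
    [IsProbabilityMeasure μ] {α : ℝ} (hα : ∀ k, RegVaryingAtZero μ (fun ω => Real.log (ε k ω)) α)
    (j : V) {δ η : ℝ} (hδ : 0 < δ) (hη : 0 < η) :
    0 < μ {ω | (1 < Z j ω ∧ ∀ l ≠ j, Z l ω < η) ∧ ∀ k, ε k ω ≤ 1 + δ} := by
  have hsupp : ∀ k x, 0 ≤ x → ∀ A : Set ℝ, IsOpen A → x ∈ A → 0 < μ (Z k ⁻¹' A) := by
    intro k x hx A hA hxA
    have hmem : x ∈ (μ.map (Z k)).support := by rw [hU.Z_support k]; exact hx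
    rw [← Measure.map_apply (hU.measurable_Z k) hA.measurableSet]
    exact (Measure.mem_support_iff_forall x).1 hmem A (hA.mem_nhds hxA)
  have hZ : 0 < μ {ω | ∀ k, Z k ω ∈ if k = j then Set.Ioi (1 : ℝ) else Set.Iio η} := by
    refine iIndepFun.measure_forall_pos hU.Z_indep (fun k => ?_) fun k => ?_
    · split_ifs
      exacts [measurableSet_Ioi, measurableSet_Iio]
    · split_ifs
      · exact hsupp k 2 two_pos.le _ isOpen_Ioi (by norm_num)
      · exact hsupp k 0 le_rfl _ isOpen_Iio hη
  have hε : 0 < μ {ω | ∀ k, ε k ω ∈ Set.Iic (1 + δ)} :=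
    iIndepFun.measure_forall_pos hU.eps_indep (fun _ => measurableSet_Iic)
      fun k => (hα k).measure_le_one_add_pos (hU.eps_one_le k) hδ
  have hmul := hU.eps_indep_Z.measure_inter_preimage_eq_mul
    {e | ∀ k, e k ∈ Set.Iic (1 + δ)}
    {z | ∀ k, z k ∈ if k = j then Set.Ioi (1 : ℝ) else Set.Iio η} ?_ ?_
  · refine lt_of_lt_of_le (ENNReal.mul_pos hε.ne' hZ.ne') (hmul.symm.le.trans (measure_mono ?_))
    rintro ω ⟨h1, h2⟩
    refine ⟨⟨by simpa using h2 j, fun l hl => by simpa [hl] using h2 l⟩, h1⟩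
  · simp only [Set.ofPred_forall]
    exact MeasurableSet.iInter fun k => measurable_pi_apply k measurableSet_Iic
  · simp only [Set.ofPred_forall]
    refine MeasurableSet.iInter fun k => measurable_pi_apply k ?_
    split_ifs
    exacts [measurableSet_Ioi, measurableSet_Iio]

end DAG.IsRecursiveMLNoise

theorem mainTheorem8 {V : Type*} [Fintype V] [DecidableEq V]
    {Ω : Type*} [MeasurableSpace Ω] (μ : Measure Ω) [IsProbabilityMeasure μ]
    (D : DAG V) (C : V → V → ℝ) (Z ε U : V → Ω → ℝ)
    (hU : D.IsRecursiveMLNoise C μ Z ε U)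
    {j i : V} (p : D.Path j i) (hp : p.IsGeneric C)
    (α : ℝ) (hα : ∀ k, RegVaryingAtZero μ (fun ω => Real.log (ε k ω)) α) :
    RegVaryingAtZero μ
      (fun ω => Real.log (U i ω / U j ω) - Real.log (D.mlCoeff C j i))
      ((p.nodeSet.card : ℝ) * α) := by
  have hC := hU.edgeWeight.1
  have hb : 0 < D.mlCoeff C j i := hp.1 ▸ p.weight_pos hC
  set S := p.nodeSet
  have hlog : ∀ k, Measurable fun ω => Real.log (ε k ω) := fun k =>
    Real.measurable_log.comp (hU.measurable_eps k)
  have hW : RegVaryingAtZero μ (fun ω => ∑ k ∈ S, Real.log (ε k ω)) (S.card * α) :=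
    RegVaryingAtZero.sum hα hlog (hU.eps_indep.comp (fun _ => Real.log) fun _ => Real.measurable_log)
      p.nodeSet_nonempty
  -- Extending the noise off `S` by 1 makes `Y₀ = logRatio ∘ rest` a function of the noise off `S`
  -- and the innovations alone, which gives its independence of `W`.
  let mask : ((Sᶜ : Finset V) → ℝ) → V → ℝ := fun y k =>
    if h : k ∈ S then 1 else y ⟨k, Finset.mem_compl.2 h⟩
  have hmask : Measurable mask := measurable_pi_lambda _ fun k => by
    by_cases h : k ∈ S
    · simp only [mask, h, dite_true, measurable_const]
    · simp only [mask, h, dite_false]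
      exact measurable_pi_apply _
  let sol : ((Sᶜ : Finset V) → ℝ) × (V → ℝ) → V → ℝ := fun x => D.solution C x.2 (mask x.1)
  have hsol : ∀ k, Measurable fun x => sol x k := fun k =>
    (D.measurable_solution C k).comp (measurable_snd.prodMk (hmask.comp measurable_fst))
  let rest : Ω → ((Sᶜ : Finset V) → ℝ) × (V → ℝ) := fun ω => (fun k => ε k ω, fun k => Z k ω)
  have hrest : Measurable rest :=
    (measurable_pi_lambda _ fun k : (Sᶜ : Finset V) => hU.measurable_eps k).prodMk
      (measurable_pi_lambda _ hU.measurable_Z)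
  have hU₀ : ∀ ω, D.IsSolution C (fun k => Z k ω) (fun k => if k ∈ S then 1 else ε k ω)
      (sol (rest ω)) := fun ω => D.isSolution_solution C _ _
  let logRatio : ((Sᶜ : Finset V) → ℝ) × (V → ℝ) → ℝ := fun x =>
    Real.log (sol x i / sol x j) - Real.log (D.mlCoeff C j i)
  have hlogRatio : Measurable logRatio :=
    (Real.measurable_log.comp ((hsol i).div (hsol j))).sub_const _
  refine hW.of_squeeze (Y₀ := logRatio ∘ rest)
    ((Real.measurable_log.comp ((hU.measurable_U i).div (hU.measurable_U j))).sub_const _)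
    (hlogRatio.comp hrest) ?_ ?_ (hU.ae_log_ratio_bounds p hp.1 hU₀)
  · have := (hU.indepFun_noise S).comp (φ := fun y : S → ℝ => ∑ k, Real.log (y k))
      (ψ := logRatio)
      (Finset.measurable_sum _ fun k _ => Real.measurable_log.comp (measurable_pi_apply k))
      hlogRatio
    convert this using 1
    funext ω
    exact (Finset.sum_coe_sort S fun k => Real.log (ε k ω)).symm
  -- On the event where `p` dominates, `U₀_i ≤ b_{ji} U₀_j`, that is, `Y₀ ≤ 0`.
  · obtain ⟨δ, hδ, η, hη, H⟩ := hp.exists_le hC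
    refine lt_of_lt_of_le (hU.measure_innovation_noise_pos hα j hδ hη) (measure_mono_ae ?_)
    filter_upwards [ae_all_iff.2 hU.Z_pos, ae_all_iff.2 hU.eps_one_le] with ω hz he
    rintro ⟨⟨hzj, hzl⟩, heδ⟩
    have hpos := (hU₀ ω).pos hz fun k => by
      have := zero_lt_one.trans_le (he k)
      split_ifs <;> simp [this]
    have hle := H _ _ _ hz hzj hzl (fun k => ?_) (fun k => ?_) (fun k hk => if_pos hk) (hU₀ ω)
    · change Real.log (sol (rest ω) i / sol (rest ω) j) - Real.log (D.mlCoeff C j i) ≤ 0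
      rw [sub_nonpos]
      exact Real.log_le_log (div_pos (hpos i) (hpos j)) ((div_le_iff₀ (hpos j)).2 hle)
    · split_ifs
      exacts [le_rfl, he k]
    · split_ifs
      exacts [by linarith, heδ k]
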